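/- Conventions: A \emph{smooth curve} over a field $K$ is a separated scheme of finite type over $K$ that is geometrically integral (geometrically irreducible and geometrically reduced) and smooth of relative dimension $1$ over $K$. A field $K$ is called \emph{ample} (or \emph{large}) if every smooth curve over $K$ which has a $K$-rational point has infinitely many $K$-rational points. For a subfield $K_0\subseteq K$, a set $X\subseteq K$ is \emph{existentially $K_0$-definable} if there is an existential first-order formula $\varphi(x)$ in the language of rings with parameters from $K_0$ (a block of existential quantifiers followed by a quantifier-free formula) such that $X=\{a\in K : K\models\varphi(a)\}$. The algebraic closure of $K_0$ is denoted by $\widetilde{K_0}$, and the cardinality of a set $S$ by $|S|$. \textbf{Lemma.} Let $K$ be a perfect ample field and $K_0\subseteq K$ a subfield. Let $X\subseteq K$ be an existentially $K_0$-definable set with $X\not\subseteq\widetilde{K_0}$ (that is, some element of $X$ is transcendental over $K_0$). Then $$|X\smallsetminus K_1|=|K|$$ for every proper subfield $K_1$ of $K$. -/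

import Mathlib

universe u

/-- A morphism `f : C ⟶ Spec K`, for a field `K`, makes `C` a smooth curve over `K`: a separated,
quasi-compact scheme, smooth of relative dimension one (in particular of finite type) and
geometrically integral (geometrically irreducible and geometrically reduced) over `K`. -/
structure IsSmoothCurve {K : Type u} [Field K] {C : AlgebraicGeometry.Scheme.{u}}
    (f : C ⟶ AlgebraicGeometry.Spec (CommRingCat.of K)) : Prop where
  isSeparated : AlgebraicGeometry.IsSeparated f
  quasiCompact : AlgebraicGeometry.QuasiCompact f
  smooth : AlgebraicGeometry.SmoothOfRelativeDimension 1 f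
  geometricallyIntegral : AlgebraicGeometry.GeometricallyIntegral f

open CategoryTheory in
/-- The `K`-rational points of a `K`-scheme `f : C ⟶ Spec K`: the sections of `f`. -/
def RationalPoints {K : Type u} [Field K] {C : AlgebraicGeometry.Scheme.{u}}
    (f : C ⟶ AlgebraicGeometry.Spec (CommRingCat.of K)) : Type u :=
  {s : AlgebraicGeometry.Spec (CommRingCat.of K) ⟶ C // s ≫ f = 𝟙 _}

/-- A field `K` is ample (also called large) if every smooth curve over `K` that has a `K`-rational
point has infinitely many of them. -/
def IsAmpleField (K : Type u) [Field K] : Prop :=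
  ∀ (C : AlgebraicGeometry.Scheme.{u}) (f : C ⟶ AlgebraicGeometry.Spec (CommRingCat.of K)),
    IsSmoothCurve f → Nonempty (RationalPoints f) → Infinite (RationalPoints f)

open FirstOrder in
/-- A subset `X` of a ring `R` is existentially `A`-definable if it is defined by an existential
formula in one free variable in the language of rings, with parameters from `A`. -/
def ExistentiallyDefinable {R : Type*} [CommRing R] (A : Set R) (X : Set R) : Prop :=
  letI := Ring.compatibleRingOfRing R
  ∃ φ : Language.ring[[A]].Formula (Fin 1),
    Language.BoundedFormula.IsExistential φ ∧ ∀ x : R, x ∈ X ↔ φ.Realize (fun _ => x)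

/-!
Let `p` be the characteristic exponent of `K` and let `x ∈ X` be transcendental over `K₀`.
Enlarging `K₀` to `F` and replacing `x` by a `p`-power root `z`, one may assume that `F` is perfect,
that `K` is algebraic over `F(z)`, and that the finitely many elements of `K` witnessing `x ∈ X`
(values of the quantified variables and inverses of the nonzero polynomial expressions) are
separable over `F(z)`. They then lie in a ring `R ⊆ K` that is étale over `F[z]`, and every
`σ : R →ₐ[F] K` maps `x` into `X`.

Given `c₁, …, cₙ ∈ K`, the fibre product over the affine line with coordinate `t` of the base
changes of `Spec R` along `t ↦ z + cᵢ t` has a rational point over `t = 0`. Taylor expansion in `t`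
embeds the functions on a neighbourhood of this point into `K⟦t⟧`, so the neighbourhood is
geometrically integral, and ampleness of `K` provides a rational point with `t ≠ 0`. Thus some
homothetic copy `z + c₁ t, …, z + cₙ t` consists of `p`-power roots of elements of `X`.

For a proper subfield `L` and `a ∉ L`, one of `w`, `w + t`, `w + a t` is outside `L`. Hence, for a
suitable `u`, every `c ∈ K` is determined by the ratio of `(c + e₁) t` and `(u + e₀) t` with
`e₀, e₁ ∈ {0, 1, a}` such that `z + (c + e₁) t` and `z + (u + e₀) t` are outside `L`. As `K` is
infinite, there are `|K|` such elements outside `L`.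
-/

section GeometricIntegrality

open PowerSeries TensorProduct

/-- The comparison map `K⟦X⟧ ⊗ L → L⟦X⟧`, `f ⊗ a ↦ a f`. -/
noncomputable def powerSeriesTensorMap (K L : Type*) [CommRing K] [CommRing L] [Algebra K L] :
    K⟦X⟧ ⊗[K] L →ₐ[K] L⟦X⟧ :=
  Algebra.TensorProduct.lift (PowerSeries.mapAlgHom (Algebra.ofId K L))
    ((Algebra.ofId L L⟦X⟧).restrictScalars K) fun _ _ => Commute.all _ _

lemma coeff_powerSeriesTensorMap_tmul {K L : Type*} [CommRing K] [CommRing L] [Algebra K L]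
    (f : K⟦X⟧) (a : L) (n : ℕ) :
    PowerSeries.coeff n (powerSeriesTensorMap K L (f ⊗ₜ a)) = PowerSeries.coeff n f • a := by
  have hf : PowerSeries.mapAlgHom (Algebra.ofId K L) f = PowerSeries.map (algebraMap K L) f := rfl
  simp [powerSeriesTensorMap, hf, Algebra.ofId_apply, PowerSeries.coeff_mul_C, Algebra.smul_def]

lemma powerSeriesTensorMap_injective (K L : Type*) [CommRing K] [CommRing L] [Algebra K L]
    [Module.Free K L] : Function.Injective (powerSeriesTensorMap K L) := by
  rw [injective_iff_map_eq_zero]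
  intro z hz
  let b := Module.Free.chooseBasis K L
  obtain ⟨f, rfl⟩ := TensorProduct.eq_repr_basis_right b z
  suffices f = 0 by simp [this]
  ext i n
  have hcoeff : ∑ j ∈ f.support, PowerSeries.coeff n (f j) • b j = 0 := by
    simpa [Finsupp.sum, coeff_powerSeriesTensorMap_tmul] using congrArg (PowerSeries.coeff n) hz
  by_cases hi : i ∈ f.support
  · simpa using linearIndependent_iff'.1 b.linearIndependent _ _ hcoeff i hi
  · simp [Finsupp.notMem_support_iff.1 hi]

lemma isDomain_tensorProduct_of_injective_powerSeries {K A : Type*} (L : Type*) [CommRing K]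
    [CommRing A] [Algebra K A] [CommRing L] [IsDomain L] [Algebra K L] [Module.Free K L]
    (φ : A →ₐ[K] K⟦X⟧) (hφ : Function.Injective φ) : IsDomain (A ⊗[K] L) := by
  have hφL : Function.Injective (Algebra.TensorProduct.map φ (AlgHom.id K L)) :=
    Module.Flat.rTensor_preserves_injective_linearMap φ.toLinearMap hφ
  exact ((powerSeriesTensorMap_injective K L).comp hφL).isDomain
    ((powerSeriesTensorMap K L).comp (Algebra.TensorProduct.map φ (AlgHom.id K L))).toRingHom

open AlgebraicGeometry CategoryTheory in
lemma geometricallyIntegral_Spec_of_injective_powerSeries {K A : Type u} [Field K] [CommRing A]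
    [Algebra K A] (φ : A →ₐ[K] K⟦X⟧) (hφ : Function.Injective φ) :
    GeometricallyIntegral (Spec.map (CommRingCat.ofHom (algebraMap K A))) := by
  constructor
  rw [geometrically_iff_of_commRing]
  intro L _ _ Y fst snd h
  have := isDomain_tensorProduct_of_injective_powerSeries L φ hφ
  let e := h.isoPullback ≪≫ pullbackSpecIso K A L
  have : Nonempty Y := ⟨e.inv (Nonempty.some inferInstance)⟩
  exact isIntegral_of_isOpenImmersion e.hom

end GeometricIntegrality

section EtaleCoordinate

open Polynomial

lemma etale_comp {A B C : Type*} [CommRing A] [CommRing B] [CommRing C] {f : A →+* B} {g : B →+* C}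
    (hf : f.Etale) (hg : g.Etale) : (g.comp f).Etale := by
  algebraize [f, g, g.comp f]
  exact Algebra.Etale.comp A B C

lemma finite_algHom_of_formallyUnramified (P B L : Type*) [CommRing P] [CommRing B] [Algebra P B]
    [Algebra.FormallyUnramified P B] [Algebra.FiniteType P B] [Field L] [Algebra P L] :
    Finite (B →ₐ[P] L) := by
  have : Module.Finite L (TensorProduct P L B) :=
    Algebra.FormallyUnramified.finite_of_free L (TensorProduct P L B)
  exact .of_equiv _ (AlgHom.liftEquiv P L B L).symm

lemma isStandardSmoothOfRelativeDimension_one_polynomial (k : Type*) [CommRing k] [Nontrivial k] :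
    Algebra.IsStandardSmoothOfRelativeDimension 1 k k[X] := by
  let b : Module.Basis Unit k[X] Ω[k[X]⁄k] :=
    (Module.Basis.singleton Unit k[X]).map (KaehlerDifferential.polynomialEquiv k).symm
  have hb : Set.range b ⊆ Set.range (KaehlerDifferential.D k k[X]) := by
    rintro _ ⟨i, rfl⟩
    exact ⟨X, by simp [b]⟩
  have : Algebra.IsStandardSmooth k k[X] := .of_basis_kaehlerDifferential b hb
  rw [Algebra.IsStandardSmoothOfRelativeDimension.iff_of_isStandardSmooth]
  simp [rank_eq_card_basis b]

/-- An element `x` of a `k`-algebra `R` is an étale coordinate if the map `Spec R → 𝔸¹` it defines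
is étale, i.e. if `R` is étale over `k[X]` via `X ↦ x`. -/
def IsEtaleCoordinate (k : Type*) {R : Type*} [CommRing k] [CommRing R] [Algebra k R] (x : R) :
    Prop :=
  (aeval x : k[X] →ₐ[k] R).toRingHom.Etale

namespace IsEtaleCoordinate

variable {k R : Type*} [CommRing k] [CommRing R] [Algebra k R] {x : R}

protected lemma X (k : Type*) [CommRing k] : IsEtaleCoordinate k (X : k[X]) := by
  rw [IsEtaleCoordinate, aeval_X_left]
  exact RingHom.Etale.containsIdentities k[X]

lemma map (hx : IsEtaleCoordinate k x) {S : Type*} [CommRing S] [Algebra k S] (f : R →ₐ[k] S)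
    (hf : f.toRingHom.Etale) : IsEtaleCoordinate k (f x) := by
  unfold IsEtaleCoordinate at hx ⊢
  rw [aeval_algHom]
  exact etale_comp hx hf

lemma sub_algebraMap (hx : IsEtaleCoordinate k x) (c : k) :
    IsEtaleCoordinate k (x - algebraMap k R c) := by
  have htranslate : (algEquivAevalXAddC (-c)).toAlgHom.toRingHom.Etale :=
    .of_bijective (algEquivAevalXAddC (-c)).bijective
  have haeval : (aeval (x - algebraMap k R c) : k[X] →ₐ[k] R) =
      (aeval x).comp (algEquivAevalXAddC (-c)).toAlgHom :=
    algHom_ext (by simp [sub_eq_add_neg])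
  unfold IsEtaleCoordinate at hx ⊢
  rw [haeval]
  exact etale_comp htranslate hx

lemma finite_fiber (hx : IsEtaleCoordinate k x) {L : Type*} [Field L] [Algebra k L] (c : L) :
    {σ : R →ₐ[k] L | σ x = c}.Finite := by
  algebraize [(aeval x : k[X] →ₐ[k] R).toRingHom, (aeval c : k[X] →ₐ[k] L).toRingHom]
  have : Algebra.Etale k[X] R := hx
  have := finite_algHom_of_formallyUnramified k[X] R L
  have hlift : ∀ σ ∈ {σ : R →ₐ[k] L | σ x = c}, ∃ τ : R →ₐ[k[X]] L, ∀ r, τ r = σ r := by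
    rintro σ rfl
    exact ⟨{ σ.toRingHom with commutes' := fun p => (aeval_algHom_apply σ x p).symm },
      fun _ => rfl⟩
  choose τ hτ using hlift
  refine Set.finite_coe_iff.1 (Finite.of_injective (fun σ => τ σ.1 σ.2) fun σ σ' h => ?_)
  ext r
  rw [← hτ σ σ.2, ← hτ σ' σ'.2]
  exact congr($h r)

open AlgebraicGeometry in
lemma smoothOfRelativeDimension_one {k R : Type u} [CommRing k] [Nontrivial k] [CommRing R]
    [Algebra k R] {x : R} (hx : IsEtaleCoordinate k x) :
    SmoothOfRelativeDimension 1 (Spec.map (CommRingCat.ofHom (algebraMap k R))) := by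
  algebraize [(aeval x : k[X] →ₐ[k] R).toRingHom]
  have : IsScalarTower k k[X] R := .of_algebraMap_eq fun r => (aeval_C x r).symm
  have : Algebra.Etale k[X] R := hx
  have : Algebra.IsStandardSmoothOfRelativeDimension 0 k[X] R :=
    Algebra.Etale.iff_isStandardSmoothOfRelativeDimension_zero.1 inferInstance
  have := isStandardSmoothOfRelativeDimension_one_polynomial k
  have := Algebra.IsStandardSmoothOfRelativeDimension.trans 1 0 k k[X] R
  rw [HasRingHomProperty.Spec_iff (P := @SmoothOfRelativeDimension 1)]
  exact RingHom.locally_of RingHom.isStandardSmoothOfRelativeDimension_respectsIso _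
    ((RingHom.isStandardSmoothOfRelativeDimension_algebraMap 1).2 this)

end IsEtaleCoordinate

end EtaleCoordinate

section PowerSeriesPoint

open PowerSeries

lemma injective_of_maximalIdeal_eq_span_singleton {S D : Type*} [CommRing S] [IsLocalRing S]
    [IsNoetherianRing S] [CommRing D] [IsDomain D] {x : S}
    (hx : IsLocalRing.maximalIdeal S = Ideal.span {x}) (f : S →+* D) (hfx : f x ≠ 0) :
    Function.Injective f := by
  rw [injective_iff_map_eq_zero]
  intro s hs
  have hpow : ∀ n, s ∈ Ideal.span {x} ^ n := by
    intro n
    induction n with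
    | zero => simp
    | succ n ih =>
      rw [Ideal.span_singleton_pow, Ideal.mem_span_singleton] at ih ⊢
      obtain ⟨u, rfl⟩ := ih
      rw [map_mul, map_pow] at hs
      have hu : f u = 0 := (mul_eq_zero.1 hs).resolve_left (pow_ne_zero n hfx)
      have humem : u ∈ IsLocalRing.maximalIdeal S := fun hunit => (hunit.map f).ne_zero hu
      rw [hx, Ideal.mem_span_singleton] at humem
      exact pow_succ x n ▸ mul_dvd_mul_left _ humem
  have hkrull := Ideal.iInf_pow_eq_bot_of_isLocalRing (Ideal.span {x})
    (hx ▸ (IsLocalRing.maximalIdeal.isMaximal S).ne_top)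
  rwa [← Ideal.mem_iInf, hkrull, Ideal.mem_bot] at hpow

namespace IsEtaleCoordinate

variable {k R : Type*} [CommRing k] [CommRing R] [Algebra k R] {x : R}

lemma exists_algHom_powerSeries (hx : IsEtaleCoordinate k x) (σ : R →ₐ[k] k) (hσ : σ x = 0) :
    ∃ φ : R →ₐ[k] k⟦X⟧, φ x = X := by
  algebraize [(Polynomial.aeval x : Polynomial k →ₐ[k] R).toRingHom]
  have : Algebra.Etale (Polynomial k) R := hx
  have hσX (p : Polynomial k) : σ (algebraMap (Polynomial k) R p) = p.coeff 0 := by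
    rw [Polynomial.coeff_zero_eq_aeval_zero, ← hσ]
    exact (Polynomial.aeval_algHom_apply σ x p).symm
  let σ₀ : R →ₐ[Polynomial k] k⟦X⟧ ⧸ Ideal.span {(X : k⟦X⟧)} :=
    { ((Ideal.Quotient.mk _).comp (C (R := k))).comp σ.toRingHom with
      commutes' := fun p => by
        change Ideal.Quotient.mk _ (C (σ (algebraMap (Polynomial k) R p))) =
          Ideal.Quotient.mk _ (p : k⟦X⟧)
        rw [hσX, Ideal.Quotient.eq, Ideal.mem_span_singleton, X_dvd_iff]
        simp }
  obtain ⟨φ, -⟩ := Algebra.FormallySmooth.exists_mkₐ_comp_eq_of_isAdicComplete σ₀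
  have hφ (p : Polynomial k) : φ (Polynomial.aeval x p) = p := φ.commutes p
  exact ⟨{ φ.toRingHom with commutes' := fun r => by simp }, by simpa using hφ Polynomial.X⟩

end IsEtaleCoordinate

namespace IsEtaleCoordinate

variable {K B : Type*} [Field K] [CommRing B] [Algebra K B] {x : B}

lemma isNoetherianRing (hx : IsEtaleCoordinate K x) : IsNoetherianRing B := by
  algebraize [(Polynomial.aeval x : Polynomial K →ₐ[K] B).toRingHom]
  have : Algebra.Etale (Polynomial K) B := hx
  exact Algebra.FiniteType.isNoetherianRing (Polynomial K) B

lemma maximalIdeal_eq_span (hx : IsEtaleCoordinate K x) (q : Ideal B) [q.IsPrime]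
    (hq : ∀ p : Polynomial K, Polynomial.aeval x p ∈ q ↔ p.coeff 0 = 0) :
    IsLocalRing.maximalIdeal (Localization.AtPrime q) =
      Ideal.span {algebraMap B (Localization.AtPrime q) x} := by
  algebraize [(Polynomial.aeval x : Polynomial K →ₐ[K] B).toRingHom]
  have : Algebra.Etale (Polynomial K) B := hx
  let p : Ideal (Polynomial K) := q.under (Polynomial K)
  have hp : p = Ideal.span {Polynomial.X} := by
    ext f
    rw [Ideal.mem_span_singleton, Polynomial.X_dvd_iff]
    exact hq f
  have : q.LiesOver p := ⟨rfl⟩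
  let := Localization.AtPrime.algebraOfLiesOver p q
  have hmax := ((Algebra.isUnramifiedAt_iff_map_eq (Polynomial K) p q).1 inferInstance).2
  rw [← hmax, hp, Ideal.map_span, Set.image_singleton,
    IsScalarTower.algebraMap_apply (Polynomial K) B, RingHom.algebraMap_toAlgebra]
  congr!
  exact Polynomial.aeval_X x

lemma exists_mul_eq_zero_of_powerSeries (hx : IsEtaleCoordinate K x) (φ : B →ₐ[K] K⟦X⟧)
    (hφx : φ x = X) {b : B} (hb : φ b = 0) : ∃ s, constantCoeff (φ s) ≠ 0 ∧ s * b = 0 := by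
  let q : Ideal B := RingHom.ker ((constantCoeff (R := K)).comp φ.toRingHom)
  have hmem (s : B) : s ∈ q ↔ constantCoeff (φ s) = 0 := Iff.rfl
  have : q.IsPrime := RingHom.ker_isPrime _
  have hunit (s : q.primeCompl) : IsUnit (φ s) := by
    rw [isUnit_iff_constantCoeff, isUnit_iff_ne_zero]
    exact fun h => s.2 ((hmem s).2 h)
  let Φ : Localization.AtPrime q →+* K⟦X⟧ := IsLocalization.lift (g := φ.toRingHom) hunit
  have hΦ (c : B) : Φ (algebraMap B _ c) = φ c := IsLocalization.lift_eq _ c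
  have := hx.isNoetherianRing
  have : IsNoetherianRing (Localization.AtPrime q) :=
    IsLocalization.isNoetherianRing q.primeCompl _ inferInstance
  have hmax := hx.maximalIdeal_eq_span q fun p => by
    rw [hmem, ← Polynomial.aeval_algHom_apply, hφx, Polynomial.aeval_def, PowerSeries.algebraMap_eq,
      Polynomial.eval₂_C_X_eq_coe, Polynomial.constantCoeff_coe]
  have hinj := injective_of_maximalIdeal_eq_span_singleton hmax Φ (by simp [hΦ, hφx])
  have hb0 : algebraMap B (Localization.AtPrime q) b = 0 := hinj (by simp [hΦ, hb])
  obtain ⟨s, hs⟩ := (IsLocalization.map_eq_zero_iff q.primeCompl _ b).1 hb0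
  exact ⟨s, fun h => s.2 ((hmem s).2 h), hs⟩

/-- The kernel of `φ` is finitely generated and vanishes in the local ring at the special point,
hence on a neighbourhood. -/
lemma exists_mul_ker_eq_zero_of_powerSeries (hx : IsEtaleCoordinate K x) (φ : B →ₐ[K] K⟦X⟧)
    (hφx : φ x = X) : ∃ g, constantCoeff (φ g) ≠ 0 ∧ ∀ b, φ b = 0 → g * b = 0 := by
  have := hx.isNoetherianRing
  let I : Ideal B := RingHom.ker φ
  let q : PrimeSpectrum B := ⟨RingHom.ker ((constantCoeff (R := K)).comp φ.toRingHom),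
    RingHom.ker_isPrime _⟩
  have hq : q ∉ Module.support B I := Module.notMem_support_iff'.2 fun b => by
    obtain ⟨s, hs, hsb⟩ := hx.exists_mul_eq_zero_of_powerSeries φ hφx b.2
    exact ⟨s, hs, Subtype.ext hsb⟩
  rw [Module.support_eq_zeroLocus, PrimeSpectrum.mem_zeroLocus, SetLike.coe_subset_coe,
    SetLike.not_le_iff_exists] at hq
  obtain ⟨g, hg, hgq⟩ := hq
  exact ⟨g, hgq, fun b hb => congrArg Subtype.val (Module.mem_annihilator.1 hg ⟨b, hb⟩)⟩

lemma exists_localizationAway_injective (hx : IsEtaleCoordinate K x) (σ : B →ₐ[K] K)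
    (hσ : σ x = 0) : ∃ (g : B) (φ : Localization.Away g →ₐ[K] K⟦X⟧), Function.Injective φ := by
  obtain ⟨φ, hφx⟩ := hx.exists_algHom_powerSeries σ hσ
  obtain ⟨g, hg, hgker⟩ := hx.exists_mul_ker_eq_zero_of_powerSeries φ hφx
  have hunit (s : Submonoid.powers g) : IsUnit (φ s) := by
    obtain ⟨_, n, rfl⟩ := s
    simpa using (isUnit_iff_constantCoeff.2 (isUnit_iff_ne_zero.2 hg)).pow n
  refine ⟨g, IsLocalization.liftAlgHom (M := Submonoid.powers g) hunit,
    (IsLocalization.lift_injective_iff _).2 fun a b => ⟨fun h => ?_, fun h => ?_⟩⟩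
  · simpa using! congrArg (IsLocalization.lift (M := Submonoid.powers g) hunit) h
  · refine IsLocalization.eq_iff_exists _ _ |>.2 ⟨⟨g, Submonoid.mem_powers g⟩, ?_⟩
    simpa [mul_sub, sub_eq_zero] using hgker (a - b) (by rw [map_sub]; exact sub_eq_zero.2 h)

end IsEtaleCoordinate

end PowerSeriesPoint

section AmpleFields

open AlgebraicGeometry CategoryTheory PowerSeries

/-- The rational points of an affine scheme `Spec A` over `K`, as `K`-algebra homomorphisms. -/
noncomputable def algHomEquivRationalPoints (K A : Type u) [Field K] [CommRing A] [Algebra K A] :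
    (A →ₐ[K] K) ≃ RationalPoints (Spec.map (CommRingCat.ofHom (algebraMap K A))) where
  toFun σ := ⟨Spec.map (CommRingCat.ofHom σ.toRingHom), by
    rw [← Spec.map_comp, ← CommRingCat.ofHom_comp, ← Spec.map_id]
    congr 1
    ext r
    exact σ.commutes r⟩
  invFun s :=
    { (Spec.preimage s.1).hom with
      commutes' := fun r => by
        have hs : CommRingCat.ofHom (algebraMap K A) ≫ Spec.preimage s.1 = 𝟙 _ :=
          Spec.map_injective (by rw [Spec.map_comp, Spec.map_preimage, Spec.map_id, s.2])
        exact congr($(hs).hom r) }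
  left_inv σ := by
    ext a
    exact congr($(Spec.preimage_map (CommRingCat.ofHom σ.toRingHom)).hom a)
  right_inv s := Subtype.ext (Spec.map_preimage s.1)

lemma IsEtaleCoordinate.isSmoothCurve {K A : Type u} [Field K] [CommRing A] [Algebra K A] {x : A}
    (hx : IsEtaleCoordinate K x) (φ : A →ₐ[K] K⟦X⟧) (hφ : Function.Injective φ) :
    IsSmoothCurve (Spec.map (CommRingCat.ofHom (algebraMap K A))) :=
  ⟨inferInstance, inferInstance, hx.smoothOfRelativeDimension_one,
    geometricallyIntegral_Spec_of_injective_powerSeries φ hφ⟩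

namespace IsAmpleField

variable {K A : Type u} [Field K] [CommRing A] [Algebra K A] {x : A}

lemma infinite_algHom_of_injective_powerSeries (hK : IsAmpleField K) (hx : IsEtaleCoordinate K x)
    (φ : A →ₐ[K] K⟦X⟧) (hφ : Function.Injective φ) : Infinite (A →ₐ[K] K) := by
  let σ : A →ₐ[K] K :=
    (AlgHom.mk (constantCoeff (R := K)) fun r => by simp).comp φ
  let e := algHomEquivRationalPoints K A
  have := hK _ _ (hx.isSmoothCurve φ hφ) ⟨e σ⟩
  exact .of_injective e.symm e.symm.injective

lemma infinite_algHom (hK : IsAmpleField K) (hx : IsEtaleCoordinate K x) (σ : A →ₐ[K] K) :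
    Infinite (A →ₐ[K] K) := by
  obtain ⟨g, φ, hφ⟩ := (hx.sub_algebraMap (σ x)).exists_localizationAway_injective σ (by simp)
  have : Algebra.Etale A (Localization.Away g) := .of_isLocalizationAway g
  have hxg : IsEtaleCoordinate K (IsScalarTower.toAlgHom K A (Localization.Away g) x) :=
    hx.map _ (RingHom.etale_algebraMap.2 this)
  have := hK.infinite_algHom_of_injective_powerSeries hxg φ hφ
  exact .of_injective (fun τ : Localization.Away g →ₐ[K] K => τ.comp (IsScalarTower.toAlgHom K A _))
    fun _ _ h => IsLocalization.algHom_ext (Submonoid.powers g) h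

lemma exists_algHom_apply_ne (hK : IsAmpleField K) (hx : IsEtaleCoordinate K x) (σ : A →ₐ[K] K)
    (c : K) : ∃ τ : A →ₐ[K] K, τ x ≠ c := by
  by_contra! h
  have := hK.infinite_algHom hx σ
  exact Set.infinite_univ ((hx.finite_fiber c).subset fun τ _ => h τ)

end IsAmpleField

end AmpleFields

section MovingPoints

open Polynomial TensorProduct

/-- `D` is the coordinate ring of the fibre product of `b : Spec B → 𝔸¹` and `y : Spec R → 𝔸¹`, and
`Ψ` the point defined by `ψ` and `ρ`. -/
lemma IsEtaleCoordinate.exists_etale_pullback {k L : Type*} [CommRing k] [CommRing L] [Algebra k L]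
    {B R : Type u} [CommRing B] [Algebra k B] [CommRing R] [Algebra k R] {y : R}
    (hy : IsEtaleCoordinate k y) (b : B) (ψ : B →ₐ[k] L) (ρ : R →ₐ[k] L) (hb : ψ b = ρ y) :
    ∃ (D : Type u) (_ : CommRing D) (_ : Algebra k D) (j : B →ₐ[k] D) (ι : R →ₐ[k] D)
      (Ψ : D →ₐ[k] L), j.toRingHom.Etale ∧ ι y = j b ∧ Ψ.comp j = ψ := by
  algebraize [(aeval b : k[X] →ₐ[k] B).toRingHom, (aeval y : k[X] →ₐ[k] R).toRingHom,
    (aeval (ρ y) : k[X] →ₐ[k] L).toRingHom]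
  have : Algebra.Etale k[X] R := hy
  have : IsScalarTower k k[X] B := .of_algebraMap_eq fun r => (aeval_C b r).symm
  have : IsScalarTower k k[X] R := .of_algebraMap_eq fun r => (aeval_C y r).symm
  have : IsScalarTower k k[X] L := .of_algebraMap_eq fun r => (aeval_C (ρ y) r).symm
  let ψ' : B →ₐ[k[X]] L := { ψ.toRingHom with
    commutes' := fun p => by
      rw [RingHom.algebraMap_toAlgebra, RingHom.algebraMap_toAlgebra, ← hb]
      exact (aeval_algHom_apply ψ b p).symm }
  let ρ' : R →ₐ[k[X]] L :=
    { ρ.toRingHom with commutes' := fun p => (aeval_algHom_apply ρ y p).symm }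
  let Ψ : B ⊗[k[X]] R →ₐ[k[X]] L := Algebra.TensorProduct.lift ψ' ρ' fun _ _ => Commute.all _ _
  have hX : algebraMap k[X] B X = b := aeval_X b
  have hX' : algebraMap k[X] R X = y := aeval_X y
  refine ⟨B ⊗[k[X]] R, inferInstance, inferInstance, IsScalarTower.toAlgHom k B _,
    (Algebra.TensorProduct.includeRight : R →ₐ[k[X]] B ⊗[k[X]] R).restrictScalars k,
    Ψ.restrictScalars k, RingHom.etale_algebraMap.2 inferInstance, ?_, ?_⟩
  · rw [← hX, ← hX']
    exact (Algebra.TensorProduct.algebraMap_apply' X).symm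
  · ext c
    change Ψ (c ⊗ₜ 1) = ψ c
    rw [Algebra.TensorProduct.lift_tmul, map_one, mul_one]
    rfl

lemma IsEtaleCoordinate.exists_common_refinement {k : Type*} [CommRing k] {K R : Type u}
    [CommRing K] [Algebra k K] [CommRing R] [Algebra k R] {y : R} (hy : IsEtaleCoordinate k y)
    (ρ : R →ₐ[k] K) (s : Finset K) :
    ∃ (B : Type u) (_ : CommRing B) (_ : Algebra K B) (_ : Algebra k B) (_ : IsScalarTower k K B)
      (x : B) (ψ : B →ₐ[K] K), IsEtaleCoordinate K x ∧ ψ x = 0 ∧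
        ∀ c ∈ s, ∃ ι : R →ₐ[k] B, ι y = algebraMap K B (ρ y) + c • x := by
  classical
  induction s using Finset.induction_on with
  | empty => exact ⟨K[X], _, _, _, inferInstance, X, aeval 0, .X K, by simp, by simp⟩
  | insert c s _ ih =>
    obtain ⟨B, _, _, _, _, x, ψ, hx, hψx, hB⟩ := ih
    obtain ⟨D, _, _, j, ι, Ψ, hj, hι, hΨ⟩ := hy.exists_etale_pullback
      (algebraMap K B (ρ y) + c • x) (ψ.restrictScalars k) ρ (by simp [hψx])
    let : Algebra K D := (j.toRingHom.comp (algebraMap K B)).toAlgebra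
    let jK : B →ₐ[K] D := { j.toRingHom with commutes' := fun _ => rfl }
    have hjK (b : B) : j b = jK b := rfl
    have hΨj (b : B) : Ψ (jK b) = ψ b := congr($hΨ b)
    have : IsScalarTower k K D := .of_algebraMap_eq fun a => by
      rw [← j.commutes, IsScalarTower.algebraMap_apply k K B]
      rfl
    let ΨK : D →ₐ[K] K := { Ψ.toRingHom with
      commutes' := fun r => (hΨj _).trans (ψ.commutes r) }
    refine ⟨D, _, _, _, inferInstance, jK x, ΨK, hx.map jK hj, (hΨj x).trans hψx, fun d hd => ?_⟩
    rcases Finset.mem_insert.1 hd with rfl | hd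
    · exact ⟨ι, by simp [hι, hjK]⟩
    · obtain ⟨ι', hι'⟩ := hB d hd
      exact ⟨j.comp ι', by simp [hι', hjK]⟩

lemma IsAmpleField.exists_algHom_apply_eq_add_mul {k : Type*} [CommRing k] {K R : Type u} [Field K]
    [Algebra k K] [CommRing R] [Algebra k R] {y : R} (hK : IsAmpleField K)
    (hy : IsEtaleCoordinate k y) (ρ : R →ₐ[k] K) (s : Finset K) :
    ∃ t ≠ 0, ∀ c ∈ s, ∃ σ : R →ₐ[k] K, σ y = ρ y + c * t := by
  obtain ⟨B, _, _, _, _, x, ψ, hx, -, hB⟩ := hy.exists_common_refinement ρ s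
  obtain ⟨τ, hτ⟩ := hK.exists_algHom_apply_ne hx ψ 0
  refine ⟨τ x, hτ, fun c hc => ?_⟩
  obtain ⟨ι, hι⟩ := hB c hc
  exact ⟨(τ.restrictScalars k).comp ι, by simp [hι]⟩

end MovingPoints

section Specialization

open FirstOrder Language Ring

section

variable {K : Type*} [Field K] [CompatibleRing K] {K₀ : Subfield K} {α : Type*}

lemma exists_forall_realize_term_eq {R : Type*} [CommRing R] [Algebra K₀ R]
    (t : Language.ring[[(K₀ : Set K)]].Term α) (v : α → R) :
    ∃ a : R, ∀ σ : R →ₐ[K₀] K, t.realize (σ ∘ v) = σ a := by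
  induction t with
  | var i => exact ⟨v i, fun σ => rfl⟩
  | @func n f ts ih =>
    choose a ha using ih
    have hfun (σ : R →ₐ[K₀] K) :
        (Term.func f ts).realize (σ ∘ v) = Structure.funMap f fun i => σ (a i) := by
      simp only [Term.realize_func, ha]
    rcases f with f | f
    · cases f with
      | add => exact ⟨a 0 + a 1, fun σ => by
          rw [hfun, map_add]; exact CompatibleRing.funMap_add _⟩
      | mul => exact ⟨a 0 * a 1, fun σ => by
          rw [hfun, map_mul]; exact CompatibleRing.funMap_mul _⟩
      | neg => exact ⟨-a 0, fun σ => by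
          rw [hfun, map_neg]; exact CompatibleRing.funMap_neg _⟩
      | zero => exact ⟨0, fun σ => by
          rw [hfun, map_zero]; exact CompatibleRing.funMap_zero _⟩
      | one => exact ⟨1, fun σ => by
          rw [hfun, map_one]; exact CompatibleRing.funMap_one _⟩
    · match n, f with
      | 0, f =>
        let c : K₀ := f
        exact ⟨algebraMap K₀ R c, fun σ => (σ.commutes c).symm⟩

/-- Adjoining the inverse of a nonzero difference of two terms to `R` keeps it nonzero under
every homomorphism from `R`. -/
lemma exists_finset_realize_iff_of_isQF {n : ℕ}
    {φ : Language.ring[[(K₀ : Set K)]].BoundedFormula α n} (hφ : φ.IsQF) (v : α → K)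
    (xs : Fin n → K) :
    ∃ S : Finset K, ∀ R : Subalgebra K₀ K, (S : Set K) ⊆ R →
      ∀ (σ : R →ₐ[K₀] K) (v' : α → R) (xs' : Fin n → R), R.val ∘ v' = v → R.val ∘ xs' = xs →
        (φ.Realize v xs ↔ φ.Realize (σ ∘ v') (σ ∘ xs')) := by
  classical
  induction hφ with
  | falsum => exact ⟨∅, fun _ _ _ _ _ _ _ => Iff.rfl⟩
  | of_isAtomic h =>
    cases h with
    | rel R ts => rcases R with R | R <;> cases R
    | equal t₁ t₂ =>
      refine ⟨{(t₁.realize (Sum.elim v xs) - t₂.realize (Sum.elim v xs))⁻¹},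
        fun R hS σ v' xs' hv hxs => ?_⟩
      subst hv hxs
      obtain ⟨a₁, h₁⟩ := exists_forall_realize_term_eq t₁ (Sum.elim v' xs')
      obtain ⟨a₂, h₂⟩ := exists_forall_realize_term_eq t₂ (Sum.elim v' xs')
      simp only [BoundedFormula.realize_bdEqual, ← Sum.comp_elim, h₁, h₂] at hS ⊢
      have hinv : (R.val a₁ - R.val a₂)⁻¹ ∈ R := by simpa using hS
      refine ⟨fun h => congrArg σ (Subtype.ext h), fun h => ?_⟩
      by_contra hne
      have hunit : (a₁ - a₂) * ⟨_, hinv⟩ = 1 := Subtype.ext (mul_inv_cancel₀ (sub_ne_zero.2 hne))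
      have hσ := congrArg σ hunit
      rw [map_mul, map_sub, h, sub_self, zero_mul, map_one] at hσ
      exact zero_ne_one hσ
  | imp _ _ ih₁ ih₂ =>
    obtain ⟨S₁, h₁⟩ := ih₁
    obtain ⟨S₂, h₂⟩ := ih₂
    refine ⟨S₁ ∪ S₂, fun R hS σ v' xs' hv hxs => ?_⟩
    rw [Finset.coe_union, Set.union_subset_iff] at hS
    rw [BoundedFormula.realize_imp, BoundedFormula.realize_imp,
      h₁ R hS.1 σ v' xs' hv hxs, h₂ R hS.2 σ v' xs' hv hxs]

lemma exists_finset_realize_of_isExistential {n : ℕ}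
    {φ : Language.ring[[(K₀ : Set K)]].BoundedFormula α n} (hφ : φ.IsExistential) (v : α → K)
    (xs : Fin n → K) (h : φ.Realize v xs) :
    ∃ S : Finset K, ∀ R : Subalgebra K₀ K, (S : Set K) ⊆ R →
      ∀ (σ : R →ₐ[K₀] K) (v' : α → R) (xs' : Fin n → R), R.val ∘ v' = v → R.val ∘ xs' = xs →
        φ.Realize (σ ∘ v') (σ ∘ xs') := by
  classical
  induction hφ with
  | of_isQF hφ =>
    obtain ⟨S, hS⟩ := exists_finset_realize_iff_of_isQF hφ v xs
    exact ⟨S, fun R hSR σ v' xs' hv hxs => (hS R hSR σ v' xs' hv hxs).1 h⟩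
  | ex _ ih =>
    obtain ⟨y, hy⟩ := BoundedFormula.realize_ex.1 h
    obtain ⟨S, hS⟩ := ih _ hy
    refine ⟨insert y S, fun R hSR σ v' xs' hv hxs => ?_⟩
    rw [Finset.coe_insert, Set.insert_subset_iff] at hSR
    obtain ⟨hyR, hSR⟩ := hSR
    refine BoundedFormula.realize_ex.2 ⟨σ ⟨y, hyR⟩, ?_⟩
    rw [← Fin.comp_snoc]
    exact hS R hSR σ v' _ hv (by rw [Fin.comp_snoc, hxs]; rfl)

end

lemma ExistentiallyDefinable.exists_specialization {K : Type*} [Field K] {K₀ : Subfield K}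
    {X : Set K} (hX : ExistentiallyDefinable (K₀ : Set K) X) {x : K} (hx : x ∈ X) :
    ∃ S : Finset K, ∀ R : Subalgebra K₀ K, (S : Set K) ⊆ R →
      ∀ (σ : R →ₐ[K₀] K) (hxR : x ∈ R), σ ⟨x, hxR⟩ ∈ X := by
  let := FirstOrder.Ring.compatibleRingOfRing K
  obtain ⟨φ, hφ, hφX⟩ := hX
  obtain ⟨S, hS⟩ := exists_finset_realize_of_isExistential hφ _ _ ((hφX x).1 hx)
  refine ⟨S, fun R hSR σ hxR => (hφX _).2 ?_⟩
  have hσ := hS R hSR σ (fun _ => ⟨x, hxR⟩) default rfl (Subsingleton.elim _ _)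
  rwa [Subsingleton.elim (σ ∘ default) default] at hσ

end Specialization

section PerfectFields

open Polynomial

lemma perfectField_algebraicClosure (F E : Type*) [Field F] [Field E] [Algebra F E]
    [PerfectField E] : PerfectField (algebraicClosure F E) := by
  refine perfectField_of_perfectClosure_eq_bot _ E (eq_bot_iff.2 ?_)
  rw [← algebraicClosure.algebraicClosure_eq_bot F E]
  exact fun y hy => mem_algebraicClosure_iff.2
    (perfectClosure.isAlgebraic (algebraicClosure F E) E |>.1 ⟨y, hy⟩ |>.algebraMap)

lemma exists_isAlgebraic_adjoin_simple {k K : Type*} [Field k] [Field K] [Algebra k K] {x : K}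
    (hx : Transcendental k x) :
    ∃ F : IntermediateField k K, Transcendental F x ∧
      Algebra.IsAlgebraic (IntermediateField.adjoin F {x}) K := by
  obtain ⟨s, hxs, hs⟩ := exists_isTranscendenceBasis_superset
    ((algebraicIndependent_singleton_iff (⟨x, rfl⟩ : ({x} : Set K))).2 hx)
  rw [Set.singleton_subset_iff] at hxs
  refine ⟨IntermediateField.adjoin k (s \ {x}), ?_, ?_⟩
  · have h := hs.1.transcendental_adjoin (i := ⟨x, hxs⟩) (s := {⟨x, hxs⟩}ᶜ) (by simp)
    have himage : ((↑) : s → K) '' {⟨x, hxs⟩}ᶜ = s \ {x} := by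
      ext y
      simp
    rw [himage] at h
    open scoped IntermediateField.algebraAdjoinAdjoin in
    exact mt (IsFractionRing.isAlgebraic_iff (Algebra.adjoin k (s \ {x})) _ K).2 h
  · have h := hs.isAlgebraic_field
    rw [Subtype.range_coe, ← Set.sdiff_union_of_subset (Set.singleton_subset_iff.2 hxs),
      ← IntermediateField.adjoin_adjoin_left] at h
    exact h

lemma exists_perfectField_isAlgebraic_adjoin_simple {k K : Type*} [Field k] [Field K]
    [PerfectField K] [Algebra k K] {x : K} (hx : Transcendental k x) :
    ∃ F : IntermediateField k K, PerfectField F ∧ Transcendental F x ∧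
      Algebra.IsAlgebraic (IntermediateField.adjoin F {x}) K := by
  obtain ⟨F₀, hF₀, halg⟩ := exists_isAlgebraic_adjoin_simple hx
  let F := algebraicClosure F₀ K
  refine ⟨F.restrictScalars k, perfectField_algebraicClosure F₀ K, hF₀.algebraicClosure, ?_⟩
  have hle : IntermediateField.adjoin F₀ {x} ≤
      (IntermediateField.adjoin F {x}).restrictScalars F₀ :=
    IntermediateField.adjoin_simple_le_iff.2 (IntermediateField.mem_adjoin_simple_self F x)
  let := (IntermediateField.inclusion hle).toRingHom.toAlgebra
  have : IsScalarTower (IntermediateField.adjoin F₀ {x})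
    ((IntermediateField.adjoin F {x}).restrictScalars F₀) K := .of_algebraMap_eq fun _ => rfl
  exact (Algebra.IsAlgebraic.tower_top (K := IntermediateField.adjoin F₀ {x})
    ((IntermediateField.adjoin F {x}).restrictScalars F₀) : Algebra.IsAlgebraic _ K)

lemma isSeparable_map {F E F' E' : Type*} [Field F] [CommRing E] [Algebra F E] [Field F']
    [CommRing E'] [Algebra F' E'] (j : F →+* F') (f : E →+* E')
    (hjf : (algebraMap F' E').comp j = f.comp (algebraMap F E)) {s : E} (hs : IsSeparable F s) :
    IsSeparable F' (f s) := by
  have hroot : aeval (f s) ((minpoly F s).map j) = 0 := by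
    rw [aeval_def, eval₂_map, hjf, ← hom_eval₂, ← aeval_def, minpoly.aeval, map_zero]
  exact (Separable.map (f := j) hs).of_dvd (minpoly.dvd _ _ hroot)

lemma iterateFrobeniusEquiv_symm_mem_adjoin {k K : Type*} [Field k] [PerfectField k] [Field K]
    [PerfectField K] [Algebra k K] (q n : ℕ) [ExpChar K q] {x y : K}
    (hy : y ∈ IntermediateField.adjoin k {x}) :
    (iterateFrobeniusEquiv K q n).symm y ∈
      IntermediateField.adjoin k {(iterateFrobeniusEquiv K q n).symm x} := by
  have : ExpChar k q := (algebraMap k K).expChar (algebraMap k K).injective q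
  induction hy using IntermediateField.adjoin_induction with
  | mem y hy =>
    rw [Set.mem_singleton_iff.1 hy]
    exact IntermediateField.mem_adjoin_simple_self k _
  | algebraMap a =>
    obtain ⟨b, rfl⟩ := (iterateFrobeniusEquiv k q n).surjective a
    rw [iterateFrobeniusEquiv_def, map_pow, ← iterateFrobeniusEquiv_def, RingEquiv.symm_apply_apply]
    exact IntermediateField.algebraMap_mem _ b
  | add a b _ _ ha hb => rw [map_add]; exact add_mem ha hb
  | inv a _ ha => rw [map_inv₀]; exact inv_mem ha
  | mul a b _ _ ha hb => rw [map_mul]; exact mul_mem ha hb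

lemma exists_isSeparable_adjoin_iterateFrobeniusEquiv_symm {k K : Type*} [Field k] [PerfectField k]
    [Field K] [PerfectField K] [Algebra k K] (q : ℕ) [ExpChar K q] (x : K)
    [Algebra.IsAlgebraic (IntermediateField.adjoin k {x}) K] (S : Finset K) :
    ∃ n, ∀ s ∈ S,
      IsSeparable (IntermediateField.adjoin k {(iterateFrobeniusEquiv K q n).symm x}) s := by
  let M := IntermediateField.adjoin k {x}
  have : ExpChar (separableClosure M K) q := IntermediateField.expChar' _ q
  have hpow (s : K) : ∃ n, s ^ q ^ n ∈ separableClosure M K := by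
    obtain ⟨n, y, hy⟩ := IsPurelyInseparable.pow_mem (separableClosure M K) q s
    exact ⟨n, hy ▸ y.2⟩
  choose m hm using hpow
  let n := S.sup m
  let φ := iterateFrobeniusEquiv K q n
  refine ⟨n, fun s hs => ?_⟩
  have hsep : IsSeparable M (φ s) := by
    rw [← mem_separableClosure_iff, iterateFrobeniusEquiv_def,
      ← Nat.add_sub_cancel' (show m s ≤ n from Finset.le_sup (f := m) hs), pow_add, pow_mul]
    exact pow_mem (hm s) _
  let j : M →+* IntermediateField.adjoin k {φ.symm x} :=
    ((φ.symm : K →+* K).comp (algebraMap M K)).codRestrict _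
      fun y => iterateFrobeniusEquiv_symm_mem_adjoin q n y.2
  simpa using isSeparable_map j (φ.symm : K →+* K) rfl hsep

end PerfectFields

section EtaleModels

open Polynomial

lemma formallyEtale_aeval_gen {k K : Type*} [Field k] [Field K] [Algebra k K] {z : K}
    (hz : Transcendental k z) :
    (aeval (IntermediateField.AdjoinSimple.gen k z) : k[X] →ₐ[k] _).toRingHom.FormallyEtale := by
  let M := IntermediateField.adjoin k {z}
  algebraize [(aeval (IntermediateField.AdjoinSimple.gen k z) : k[X] →ₐ[k] M).toRingHom]
  have : IsFractionRing k[X] M :=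
    IsLocalization.isLocalization_of_algEquiv (nonZeroDivisors k[X]) (S := RatFunc k)
      (AlgEquiv.ofRingEquiv (f := (RatFunc.algEquivOfTranscendental z hz).toRingEquiv)
        fun p => RatFunc.algEquivOfTranscendental_algebraMap z hz p)
  exact Algebra.FormallyEtale.of_isLocalization (nonZeroDivisors k[X])

lemma formallyEtale_aeval_of_isSeparable {k K : Type*} [Field k] [Field K] [Algebra k K]
    (E : IntermediateField k K) (z : E) (hz : Transcendental k (z : K))
    (hE : ∀ e : E, IsSeparable (IntermediateField.adjoin k {(z : K)}) (e : K)) :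
    (aeval z : k[X] →ₐ[k] E).toRingHom.FormallyEtale := by
  let M := IntermediateField.adjoin k {(z : K)}
  have hME : M ≤ E := IntermediateField.adjoin_simple_le_iff.2 z.2
  let zM : M := IntermediateField.AdjoinSimple.gen k (z : K)
  have hM : (aeval zM : k[X] →ₐ[k] M).toRingHom.FormallyEtale := formallyEtale_aeval_gen hz
  algebraize [(aeval z : k[X] →ₐ[k] E).toRingHom, (aeval zM : k[X] →ₐ[k] M).toRingHom,
    (IntermediateField.inclusion hME).toRingHom]
  have : IsScalarTower k[X] M E := .of_algebraMap_eq fun p =>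
    aeval_algHom_apply (IntermediateField.inclusion hME) zM p
  have : IsScalarTower M E K := .of_algebraMap_eq fun _ => rfl
  have : Algebra.IsSeparable M E := ⟨fun e => IsSeparable.tower_bot (E := K) (hE e)⟩
  have : Algebra.FormallyEtale M E := .of_isSeparable M E
  exact Algebra.FormallyEtale.comp k[X] M E

lemma exists_etale_localizationAway_of_formallyEtale_fractionRing (P A E : Type*) [CommRing P]
    [CommRing A] [IsDomain A] [Algebra P A] [Algebra.FinitePresentation P A] [CommRing E]
    [Algebra A E] [IsFractionRing A E] [Algebra P E] [IsScalarTower P A E]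
    [Algebra.FormallyEtale P E] :
    ∃ f : A, f ≠ 0 ∧ Algebra.Etale P (Localization.Away f) := by
  have : IsLocalization (⊥ : Ideal A).primeCompl E := by
    rw [Ideal.primeCompl_bot]
    infer_instance
  have : Algebra.IsEtaleAt P (⊥ : Ideal A) :=
    .of_equiv ((IsLocalization.algEquiv (⊥ : Ideal A).primeCompl E
      (Localization.AtPrime (⊥ : Ideal A))).restrictScalars P)
  obtain ⟨f, hf, hetale⟩ := Algebra.exists_etale_of_isEtaleAt (R := P) (⊥ : Ideal A)
  exact ⟨f, hf, hetale⟩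

open scoped IntermediateField.algebraAdjoinAdjoin in
lemma exists_etale_localizationAway_adjoin {k K : Type*} [Field k] [Field K] [Algebra k K]
    {T : Set K} (hT : T.Finite) (z : Algebra.adjoin k T) (hz : Transcendental k (z : K))
    (hsep : ∀ s ∈ T, IsSeparable (IntermediateField.adjoin k {(z : K)}) s) :
    ∃ f : Algebra.adjoin k T, f ≠ 0 ∧ IsEtaleCoordinate k
      (algebraMap (Algebra.adjoin k T) (Localization.Away f) z) := by
  let M := IntermediateField.adjoin k {(z : K)}
  let E := IntermediateField.adjoin k T
  let zE : E := algebraMap (Algebra.adjoin k T) E z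
  have hle : E ≤ (separableClosure M K).restrictScalars k :=
    IntermediateField.adjoin_le_iff.2 fun s hs => mem_separableClosure_iff.2 (hsep s hs)
  have hE : (aeval zE : k[X] →ₐ[k] E).toRingHom.FormallyEtale :=
    formallyEtale_aeval_of_isSeparable E zE hz fun e => mem_separableClosure_iff.1 (hle e.2)
  algebraize [(aeval z : k[X] →ₐ[k] Algebra.adjoin k T).toRingHom,
    (aeval zE : k[X] →ₐ[k] E).toRingHom]
  have : IsScalarTower k k[X] (Algebra.adjoin k T) := .of_algebraMap_eq fun r => (aeval_C z r).symm
  have : IsScalarTower k[X] (Algebra.adjoin k T) E := .of_algebraMap_eq fun p =>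
    aeval_algHom_apply (IsScalarTower.toAlgHom k (Algebra.adjoin k T) E) z p
  have : Algebra.FiniteType k (Algebra.adjoin k T) :=
    (Subalgebra.fg_iff_finiteType _).1 (Subalgebra.fg_def.2 ⟨T, hT, rfl⟩)
  have : Algebra.FinitePresentation k[X] (Algebra.adjoin k T) :=
    Algebra.FinitePresentation.of_finiteType.1 (.of_restrictScalars_finiteType k k[X] _)
  obtain ⟨f, hf, hetale⟩ := exists_etale_localizationAway_of_formallyEtale_fractionRing k[X]
    (Algebra.adjoin k T) E
  have haeval : (aeval (algebraMap (Algebra.adjoin k T) (Localization.Away f) z)).toRingHom =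
      algebraMap k[X] (Localization.Away f) :=
    RingHom.ext fun p => (aeval_algebraMap_apply (Localization.Away f) z p).trans
      (IsScalarTower.algebraMap_apply k[X] (Algebra.adjoin k T) _ p).symm
  refine ⟨f, hf, ?_⟩
  rw [IsEtaleCoordinate, haeval]
  exact RingHom.etale_algebraMap.2 hetale

lemma exists_subalgebra_isEtaleCoordinate {k K : Type*} [Field k] [Field K] [Algebra k K] {z : K}
    (hz : Transcendental k z) (S : Finset K)
    (hS : ∀ s ∈ S, IsSeparable (IntermediateField.adjoin k {z}) s) :
    ∃ (R : Subalgebra k K) (hzR : z ∈ R), (S : Set K) ⊆ R ∧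
      IsEtaleCoordinate k (⟨z, hzR⟩ : R) := by
  let T : Set K := insert z S
  let A := Algebra.adjoin k T
  let zA : A := ⟨z, Algebra.subset_adjoin (Set.mem_insert z _)⟩
  obtain ⟨f, hf, hetale⟩ := exists_etale_localizationAway_adjoin (k := k)
    (S.finite_toSet.insert z) zA hz (Set.forall_mem_insert.2
      ⟨isSeparable_algebraMap (IntermediateField.AdjoinSimple.gen k z), hS⟩)
  have hunit (s : Submonoid.powers f) : IsUnit (A.val s) := by
    obtain ⟨_, n, rfl⟩ := s
    simp [hf]
  let g : Localization.Away f →ₐ[k] K := IsLocalization.liftAlgHom hunit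
  have hgA (a : A) : g (algebraMap A _ a) = a := IsLocalization.lift_eq hunit a
  have hg : Function.Injective g := (IsLocalization.lift_injective_iff hunit).2 fun a b =>
    ⟨fun h => congrArg A.val (IsLocalization.injective _
      (powers_le_nonZeroDivisors_of_noZeroDivisors hf) h), fun h => congrArg _ (Subtype.ext h)⟩
  have hTR (t : K) (ht : t ∈ T) : t ∈ g.range := ⟨_, hgA ⟨t, Algebra.subset_adjoin ht⟩⟩
  refine ⟨g.range, hTR z (Set.mem_insert z _), fun s hs => hTR s (Set.mem_insert_of_mem z hs), ?_⟩
  convert hetale.map (AlgEquiv.ofInjective g hg).toAlgHom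
    (.of_bijective (AlgEquiv.ofInjective g hg).bijective) using 1
  exact Subtype.ext (hgA zA).symm

end EtaleModels

section Homothets

/-- `Y` contains a homothetic copy of every finite set, with prescribed image `z` of the origin. -/
def ContainsHomothets {K : Type*} [Field K] (Y : Set K) (z : K) : Prop :=
  ∀ s : Finset K, ∃ t ≠ 0, ∀ c ∈ s, z + c * t ∈ Y

lemma exists_add_mul_notMem_subfield {K : Type*} [Field K] [DecidableEq K] {L : Subfield K}
    {a t : K} (ha : a ∉ L) (ht : t ≠ 0) (w : K) : ∃ e ∈ ({0, 1, a} : Finset K), w + e * t ∉ L := by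
  by_contra! h
  have hw : w ∈ L := by simpa using h 0 (by simp)
  have htL : t ∈ L := by simpa using sub_mem (h 1 (by simp)) hw
  have hat : a * t ∈ L := by simpa using sub_mem (h a (by simp)) hw
  exact ha (by simpa [ht] using div_mem hat htL)

namespace ContainsHomothets

variable {K : Type*} [Field K] {Y : Set K} {z : K} {L : Subfield K} {a : K}

open scoped Classical in
lemma exists_add_mem_sdiff (hY : ContainsHomothets Y z) (ha : a ∉ L) (u c : K) :
    ∃ t ≠ 0, ∃ e₀ ∈ ({0, 1, a} : Finset K), ∃ e₁ ∈ ({0, 1, a} : Finset K),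
      z + (u + e₀) * t ∈ Y \ L ∧ z + (c + e₁) * t ∈ Y \ L := by
  let E : Finset K := {0, 1, a}
  obtain ⟨t, ht, htY⟩ := hY (E.image (u + ·) ∪ E.image (c + ·))
  obtain ⟨e₀, he₀, h₀⟩ := exists_add_mul_notMem_subfield ha ht (z + u * t)
  obtain ⟨e₁, he₁, h₁⟩ := exists_add_mul_notMem_subfield ha ht (z + c * t)
  rw [add_assoc, ← add_mul] at h₀ h₁
  exact ⟨t, ht, e₀, he₀, e₁, he₁,
    ⟨htY _ (Finset.mem_union_left _ (Finset.mem_image_of_mem _ he₀)), h₀⟩,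
    ⟨htY _ (Finset.mem_union_right _ (Finset.mem_image_of_mem _ he₁)), h₁⟩⟩

open scoped Classical in
/-- The ratio of `w₁ - z = (c + e₁) t` and `w₀ - z = (u + e₀) t` determines `c` once
`u`, `e₀` and `e₁` are known. -/
lemma exists_surjective [Infinite K] (hY : ContainsHomothets Y z) (ha : a ∉ L) :
    ∃ g : (↥(Y \ (L : Set K)) × ↥(Y \ (L : Set K))) ×
      (({0, 1, a} : Finset K) × ({0, 1, a} : Finset K)) → K, Function.Surjective g := by
  let E : Finset K := {0, 1, a}
  obtain ⟨u, hu⟩ := Infinite.exists_notMem_finset (E.image (- ·))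
  refine ⟨fun p => (p.1.2 - z) / (p.1.1 - z) * (u + p.2.1) - p.2.2, fun c => ?_⟩
  obtain ⟨t, ht, e₀, he₀, e₁, he₁, h₀, h₁⟩ := hY.exists_add_mem_sdiff ha u c
  have hue : u + e₀ ≠ 0 := fun h =>
    hu (Finset.mem_image.2 ⟨e₀, he₀, (eq_neg_of_add_eq_zero_left h).symm⟩)
  refine ⟨((⟨_, h₀⟩, ⟨_, h₁⟩), (⟨e₀, he₀⟩, ⟨e₁, he₁⟩)), ?_⟩
  simp only [add_sub_cancel_left]
  field_simp
  ring

open Cardinal in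
lemma mk_sdiff_subfield_eq [Infinite K] (hY : ContainsHomothets Y z) (hL : L ≠ ⊤) :
    #↥(Y \ (L : Set K)) = #K := by
  classical
  obtain ⟨a, -, ha⟩ := SetLike.exists_of_lt hL.lt_top
  obtain ⟨g, hg⟩ := hY.exists_surjective ha
  refine (mk_set_le _).eq_of_not_lt fun hlt => (mk_le_of_surjective hg).not_gt ?_
  have hK : ℵ₀ ≤ #K := aleph0_le_mk K
  rw [← mul_def, ← mul_def]
  exact mul_lt_of_lt hK (mul_lt_of_lt hK hlt hlt) ((lt_aleph0_of_finite _).trans_le hK)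

end ContainsHomothets

end Homothets

lemma ExistentiallyDefinable.exists_containsHomothets {K : Type u} [Field K] [PerfectField K]
    {K₀ : Subfield K} {X : Set K} {x : K} (hX : ExistentiallyDefinable (K₀ : Set K) X)
    (hK : IsAmpleField K) (q : ℕ) [ExpChar K q] (hx : x ∈ X) (hx₀ : Transcendental K₀ x) :
    ∃ n z, ContainsHomothets (iterateFrobeniusEquiv K q n ⁻¹' X) z := by
  obtain ⟨S, hS⟩ := hX.exists_specialization hx
  obtain ⟨F, _, hxF, _⟩ := exists_perfectField_isAlgebraic_adjoin_simple hx₀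
  obtain ⟨n, hsep⟩ := exists_isSeparable_adjoin_iterateFrobeniusEquiv_symm (k := F) q x S
  let φ := iterateFrobeniusEquiv K q n
  let z := φ.symm x
  have hzx : z ^ q ^ n = x := φ.apply_symm_apply x
  have hz : Transcendental F z := fun h => hxF (hzx ▸ h.pow _)
  obtain ⟨R, hzR, hSR, hR⟩ := exists_subalgebra_isEtaleCoordinate hz S hsep
  refine ⟨n, z, fun s => ?_⟩
  obtain ⟨t, ht, hσ⟩ := hK.exists_algHom_apply_eq_add_mul hR R.val s
  refine ⟨t, ht, fun c hc => ?_⟩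
  obtain ⟨σ, hσz⟩ := hσ c hc
  have hxR : x ∈ R := hzx ▸ pow_mem hzR _
  have hxz : (⟨x, hxR⟩ : R) = ⟨z, hzR⟩ ^ q ^ n := Subtype.ext hzx.symm
  have hσx : σ ⟨x, hxR⟩ = φ (z + c * t) := by
    rw [hxz, map_pow, hσz]
    rfl
  change φ (z + c * t) ∈ X
  rw [← hσx]
  exact hS (R.restrictScalars K₀) hSR (σ.restrictScalars K₀) hxR

theorem mainTheorem4 (K : Type u) [Field K] [PerfectField K] (hK : IsAmpleField K)
    (K₀ : Subfield K) (X : Set K) (hX : ExistentiallyDefinable (K₀ : Set K) X)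
    (hX₀ : ¬ X ⊆ (algebraicClosure K₀ K : Set K))
    (K₁ : Subfield K) (hK₁ : K₁ ≠ ⊤) :
    Cardinal.mk ↥(X \ (K₁ : Set K)) = Cardinal.mk K := by
  obtain ⟨x, hx, hx'⟩ := Set.not_subset.1 hX₀
  have hx₀ : Transcendental K₀ x := fun h => hx' (mem_algebraicClosure_iff.2 h)
  have : Infinite K := hx₀.infinite
  obtain ⟨q, _⟩ := ExpChar.exists K
  obtain ⟨n, z, hz⟩ := hX.exists_containsHomothets hK q hx hx₀
  let φ := iterateFrobeniusEquiv K q n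
  have hK₁' : K₁.comap (φ : K →+* K) ≠ ⊤ := fun h => hK₁ <| eq_top_iff.2 fun y _ => by
    simpa using (h ▸ Subfield.mem_top (φ.symm y) : φ.symm y ∈ K₁.comap (φ : K →+* K))
  exact (Cardinal.mk_preimage_equiv φ.toEquiv (X \ K₁)).symm.trans (hz.mk_sdiff_subfield_eq hK₁')
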